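/- **Setting.** Let $G=(\mathcal V,\mathcal E)$ be a finite simple graph and $K$ a natural number. Every edge $e$ carries a label $f(e)\subseteq[K]$ with $f(e)=\emptyset$ (*unqualified* edge) or $|f(e)|=1$ (*qualified* edge); this is the case $M=1$. Let $\mathcal Q$ be a nonempty set of prime powers, the admissible field sizes (for instance all prime powers, or a single one). A *storage code* consists of a finite field $\mathbb F$ with $q:=|\mathbb F|\in\mathcal Q$, integers $L\ge 1$ and $L_Z\ge 0$, source symbols $W_1,\dots,W_K$ uniform on $\mathbb F^L$ and a key $\mathcal Z$ uniform on $\mathbb F^{L_Z}$, all independent, and for every node $v$ a coded symbol $V_v$ that is a function of $(W_1,\dots,W_K,\mathcal Z)$. It is *secure for $G$* if for every edge $\{v,w\}$ with label $\mathcal M$ $$H\big((W_k)_{k\in\mathcal M}\mid V_v,V_w\big)=0,\qquad I\big(V_v,V_w;(W_k)_{k\in[K]\setminus\mathcal M}\mid (W_k)_{k\in\mathcal M}\big)=0 .$$ Its source key rate is $L/L_Z\in(0,\infty]$ ($=\infty$ if $L_Z=0$), and the *source key capacity* $C(G)\in[0,\infty]$ is the supremum of the rates of all secure codes for $G$. For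 a labelled graph $H$ with labels in $[K]$, the characteristic graph $H^{[k]}$ has the nodes and edges of $H$, and an edge has the label $\{k\}$ in $H^{[k]}$ if its label in $H$ contains $k$, and the label $\emptyset$ otherwise. An *internal* qualified edge of a labelled graph is a qualified edge whose endpoints are joined by a path of unqualified edges; an *unqualified component* is a connected component of the graph of its unqualified edges. Let $\mathcal C(v)$ be the intersection of the labels of all edges at $v$. A node $v$ is *degenerate* if all edges at $v$ have the label $\mathcal C(v)$; $\mathcal V_d$ is the set of degenerate nodes. Let $\widehat G$ be the subgraph of $G$ induced on the endpoints of those qualified edges of $G$ that join two non-degenerate nodes. **Theorem.** 1. $C(G)=1$ if and only if $\widehat G$ is nonempty and, for every $k\in[K]$, the characteristic graph $\widehat G^{[k]}$ has no internal qualified edge. 2. In particular, if $G$ has no degenerate nodes, so that it equals its non-degenerate subgraph $\widetilde G=G[\mathcal V\setminus\mathcal V_d]$, then $C(G)=1$ if and only if $\widetilde G$ is nonempty and, for every $k\in[K]$, the characteristic graph $G^{[k]}$ has no internal qualified edge. 3. Suppose that no $\widehat G^{[k]}$ has an internal qualified edge. Let $\mathbb F$ be any finite field in which $K\neq 0$,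 and for every $k$ let distinct coefficients $u\in\mathbb F$ be given to the unqualified components of $\widehat G^{[k]}$. Then the following scalar code, with $L=L_Z=1$ and key $Z\in\mathbb F$, is secure for $G$ and has rate $1$: a node $v$ of $\widehat G$ stores $\sum_{k\in[K]}(u_k(v)W_k+Z)$, where $u_k(v)$ is the coefficient of the unqualified component of $v$ in $\widehat G^{[k]}$, and any other node $v$ stores $\sum_{k\in\mathcal C(v)}W_k$. -/

import Mathlib

open scoped ENNReal

namespace SecureStorage

/-! ### Shannon entropy on a finite sample space with the uniform distribution -/

section Entropy

variable {Ω α β γ : Type*}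

/-- The probability that `X = a`, for the uniform distribution on the finite sample space `Ω`. -/
noncomputable def prob (X : Ω → α) (a : α) : ℝ :=
  (Nat.card {ω // X ω = a} : ℝ) / (Nat.card Ω : ℝ)

open Classical in
/-- The Shannon entropy `H(X)`, measured in units of `log q`. -/
noncomputable def entropy [Fintype Ω] (q : ℕ) (X : Ω → α) : ℝ :=
  (∑ a ∈ Finset.univ.image X, Real.negMulLog (prob X a)) / Real.log q

/-- The conditional entropy `H(X | Y) = H(X, Y) - H(Y)`. -/
noncomputable def condEntropy [Fintype Ω] (q : ℕ) (X : Ω → α) (Y : Ω → β) : ℝ :=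
  entropy q (fun ω => (X ω, Y ω)) - entropy q Y

/-- The conditional mutual information `I(X; Y | Z) = H(X | Z) - H(X | Y, Z)`. -/
noncomputable def condMutualInfo [Fintype Ω] (q : ℕ)
    (X : Ω → α) (Y : Ω → β) (Z : Ω → γ) : ℝ :=
  condEntropy q X Z - condEntropy q X (fun ω => (Y ω, Z ω))

end Entropy

/-! ### Graphs whose edges are labelled by sets of source symbols -/

/-- A simple graph on the storage nodes `V`, together with the map `f` that associates a set of
source symbols (out of `K`) with every edge.  Only the values of `label` on edges matter. -/
structure StorageGraph (V : Type*) (K : ℕ) where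
  graph : SimpleGraph V
  label : Sym2 V → Finset (Fin K)

namespace StorageGraph

variable {V : Type*} {K : ℕ}

/-- Every edge is associated with no source symbol or with exactly `M` source symbols. -/
def HasEdgeSize (G : StorageGraph V K) (M : ℕ) : Prop :=
  ∀ e ∈ G.graph.edgeSet, G.label e = ∅ ∨ (G.label e).card = M

/-- `{v, w}` is a qualified edge. -/
def QualifiedAdj (G : StorageGraph V K) (v w : V) : Prop :=
  G.graph.Adj v w ∧ G.label s(v, w) ≠ ∅

/-- The graph of all unqualified edges.  Its walks are the unqualified paths and its connected
components are the unqualified components. -/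
def unqualifiedGraph (G : StorageGraph V K) : SimpleGraph V where
  Adj v w := G.graph.Adj v w ∧ G.label s(v, w) = ∅
  symm := ⟨fun v w h => ⟨h.1.symm, by rw [Sym2.eq_swap]; exact h.2⟩⟩
  loopless := ⟨fun v h => G.graph.loopless.irrefl v h.1⟩

/-- There is an internal qualified edge: a qualified edge whose endpoints are joined by an
unqualified path. -/
def HasInternalQualifiedEdge (G : StorageGraph V K) : Prop :=
  ∃ v w, G.QualifiedAdj v w ∧ G.unqualifiedGraph.Reachable v w

/-- The characteristic graph `G^{[k]}` of the source symbol `W_k`: the same nodes and edges, where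
an edge has the label `{W_k}` if `W_k` is in its label in `G`, and the empty label otherwise. -/
def charGraph (G : StorageGraph V K) (k : Fin K) : StorageGraph V K where
  graph := G.graph
  label e := if k ∈ G.label e then {k} else ∅

/-- The induced labelled subgraph on a set of nodes. -/
def induce (G : StorageGraph V K) (S : Set V) : StorageGraph S K where
  graph := G.graph.induce S
  label e := G.label (e.map Subtype.val)

open Classical in
/-- The common source symbols `C(v)`: the intersection of the labels of all edges at `v`. -/
noncomputable def commonSources (G : StorageGraph V K) (v : V) : Finset (Fin K) :=
  Finset.univ.filter fun k => ∀ w, G.graph.Adj v w → k ∈ G.label s(v, w)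

/-- The set `V_d` of degenerate nodes: all incident edges have the same label. -/
def degenerateNodes (G : StorageGraph V K) : Set V :=
  {v | ∀ w, G.graph.Adj v w → G.label s(v, w) = G.commonSources v}

/-- The endpoints of the qualified edges that join two non-degenerate nodes. -/
def coreNodes (G : StorageGraph V K) : Set V :=
  {v | v ∉ G.degenerateNodes ∧ ∃ w, w ∉ G.degenerateNodes ∧ G.QualifiedAdj v w}

/-- The labelled subgraph of `G` induced on `coreNodes`. -/
def core (G : StorageGraph V K) : StorageGraph G.coreNodes K :=
  G.induce G.coreNodes

end StorageGraph

/-! ### Storage codes and the source key capacity -/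

/-- The sample space of the `K` source symbols (of `L` field symbols each) and of the source key
(of `LZ` field symbols).  All field symbols are independent and uniform on `F`. -/
abbrev Sample (F : Type) (K L LZ : ℕ) : Type :=
  (Fin K → Fin L → F) × (Fin LZ → F)

/-- The source symbols with index in `S`, as a random variable. -/
def sources {F : Type} {K L LZ : ℕ} (S : Finset (Fin K)) (ω : Sample F K L LZ) :
    S → Fin L → F :=
  fun k => ω.1 k

/-- A storage code over the field `F`: every node stores a function of the source symbols and of
the source key, with an arbitrary alphabet. -/
structure StorageCode (F : Type) (V : Type*) (K : ℕ) where
  L : ℕ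
  LZ : ℕ
  L_pos : 0 < L
  alphabet : V → Type
  enc : (v : V) → Sample F K L LZ → alphabet v

namespace StorageCode

variable {F : Type} {V : Type*} {K : ℕ}

/-- The pair of coded symbols at the nodes `v` and `w`. -/
def pair (c : StorageCode F V K) (v w : V) (ω : Sample F K c.L c.LZ) :
    c.alphabet v × c.alphabet w :=
  (c.enc v ω, c.enc w ω)

/-- The code is a secure storage code for `G`: correctness `H(W_M | V_v, V_w) = 0` and security
`I(V_v, V_w; W_{[K] \ M} | W_M) = 0` on every edge `{v, w}`, where `M` is the label of the edge. -/
def IsSecure [Fintype F] (c : StorageCode F V K) (G : StorageGraph V K) : Prop :=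
  ∀ v w, G.graph.Adj v w →
    condEntropy (Fintype.card F) (sources (G.label s(v, w))) (c.pair v w) = 0 ∧
    condMutualInfo (Fintype.card F) (c.pair v w)
      (sources (G.label s(v, w))ᶜ) (sources (G.label s(v, w))) = 0

/-- The source key rate `L / L_Z`, which is `∞` if no key is used. -/
noncomputable def rate (c : StorageCode F V K) : ℝ≥0∞ :=
  (c.L : ℝ≥0∞) / (c.LZ : ℝ≥0∞)

end StorageCode

/-- The source key capacity of `G`: the supremum of the source key rates of all secure storage
codes for `G`, over finite fields whose number of elements lies in `Q`. -/
noncomputable def sourceKeyCapacity {V : Type*} {K : ℕ} (Q : Set ℕ) (G : StorageGraph V K) :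
    ℝ≥0∞ :=
  sSup {r | ∃ (F : Type) (_ : Field F) (_ : Fintype F), Fintype.card F ∈ Q ∧
    ∃ c : StorageCode F V K, c.IsSecure G ∧ r = c.rate}

open Classical in
/-- The scalar code (one field symbol per source symbol, one key symbol `Z`): a node of the core
stores `∑ k, (u W_k + Z)`, where `u` is the coefficient of its unqualified component in the
characteristic graph of `W_k`; any other node stores the sum of its common source symbols. -/
noncomputable def scalarCode {F : Type} [Field F] {V : Type*} {K : ℕ} (G : StorageGraph V K)
    (u : (k : Fin K) → (G.core.charGraph k).unqualifiedGraph.ConnectedComponent → F) :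
    StorageCode F V K where
  L := 1
  LZ := 1
  L_pos := Nat.one_pos
  alphabet _ := F
  enc v ω :=
    if h : v ∈ G.coreNodes then
      ∑ k, (u k ((G.core.charGraph k).unqualifiedGraph.connectedComponentMk ⟨v, h⟩) * ω.1 k 0
        + ω.2 0)
    else ∑ k ∈ G.commonSources v, ω.1 k 0

end SecureStorage

/-! Entropy sees a random variable only through the partition it induces on the sample space, and a
joint variable is an infimum of partitions. The converse uses only monotonicity and submodularity
(`blockEntropy_submodular`), together with the values of the entropy on the sources and on the whole
sample. Converse. A core node has an edge labelled `{k}` and, being non-degenerate, an edge avoiding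
`k`. Security on both makes its symbol independent of all sources (`IsSecure.core_indep`), so its
entropy is at most `LZ`. Decoding across a qualified core edge forces entropy at least `L`, hence `L
≤ LZ`. Across an edge avoiding `k`, a core node leaves at most `LZ - L` of uncertainty about its
neighbour, given the sources other than `k`. A path of `n` such edges leaves at most `n (LZ - L)`
(`IsSecure.ent_walk`), whereas an edge labelled `{k}` between its ends needs `L`. So an internal
qualified edge bounds every rate by `n / (n + 1)`. Achievability. Without internal qualified edges,
coefficients that separate unqualified components differ across a core edge exactly at the sources
of its label. Subtracting the two padded sums then removes the key and reveals only the label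
(`linearCode_isSecure`). Small fields are handled by reading blocks of symbols as elements of an
extension field. An empty core needs no key, so its capacity is infinite. -/

namespace SecureStorage

/-! ### Entropy of partitions of a finite sample space -/

section BlockEntropy

variable {Ω : Type*} [Fintype Ω]

open Classical in
/-- The number of elements of the block of `ω`. -/
noncomputable def blockCard (s : Setoid Ω) (ω : Ω) : ℕ :=
  (Finset.univ.filter fun ω' => s ω' ω).card

/-- The entropy of a partition of a finite sample space, in units of `log q`: the mean of
`log (|Ω| / |block|)`. -/
noncomputable def blockEntropy (q : ℕ) (s : Setoid Ω) : ℝ :=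
  (∑ ω, Real.log ((Fintype.card Ω : ℝ) / blockCard s ω)) / (Fintype.card Ω * Real.log q)

lemma blockCard_pos (s : Setoid Ω) (ω : Ω) : 0 < blockCard s ω := by
  classical
  exact Finset.card_pos.2 ⟨ω, by simp⟩

lemma blockCard_mono {s t : Setoid Ω} (h : s ≤ t) (ω : Ω) : blockCard s ω ≤ blockCard t ω := by
  classical
  exact Finset.card_le_card fun x hx => by
    simp only [Finset.mem_filter, Finset.mem_univ, true_and] at hx ⊢
    exact h hx

lemma blockCard_congr (s : Setoid Ω) {ω ω' : Ω} (h : s ω ω') :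
    blockCard s ω = blockCard s ω' := by
  classical
  unfold blockCard
  congr 1
  ext x
  simp only [Finset.mem_filter, Finset.mem_univ, true_and]
  exact ⟨fun hx => s.trans' hx h, fun hx => s.trans' hx (s.symm' h)⟩

/-- The sum over values becomes a mean over outcomes, because each value is counted once per element
of its fibre. -/
lemma entropy_eq_blockEntropy {α : Type*} (q : ℕ) (X : Ω → α) :
    entropy q X = blockEntropy q (Setoid.ker X) := by
  classical
  have hcard : ∀ ω, (Nat.card {ω' // X ω' = X ω}) = blockCard (Setoid.ker X) ω := fun ω => by
    rw [Nat.card_eq_fintype_card, Fintype.card_subtype, blockCard]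
    congr 1
  have key : ∑ a ∈ Finset.univ.image X, Real.negMulLog (prob X a)
      = ∑ ω, (Fintype.card Ω : ℝ)⁻¹ * Real.log ((prob X (X ω))⁻¹) := by
    rw [Finset.sum_comp (fun a => (Fintype.card Ω : ℝ)⁻¹ * Real.log ((prob X a)⁻¹)) X]
    refine Finset.sum_congr rfl fun a _ => ?_
    have : prob X a = ((Finset.univ.filter fun ω => X ω = a).card : ℝ) / Fintype.card Ω := by
      rw [prob, Nat.card_eq_fintype_card, Nat.card_eq_fintype_card, Fintype.card_subtype]
    rw [Real.negMulLog, Real.log_inv, nsmul_eq_mul, this]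
    ring
  rw [entropy, key, blockEntropy, ← Finset.mul_sum, ← div_div, inv_mul_eq_div]
  congr 2
  refine Finset.sum_congr rfl fun ω _ => ?_
  rw [prob, inv_div, hcard, Nat.card_eq_fintype_card]

lemma ker_pair {Ω α β : Type*} (X : Ω → α) (Y : Ω → β) :
    Setoid.ker (fun ω => (X ω, Y ω)) = Setoid.ker X ⊓ Setoid.ker Y := by
  ext x y
  simp [Setoid.ker_def, Setoid.inf_iff_and]

lemma blockEntropy_anti {q : ℕ} {s t : Setoid Ω} (h : s ≤ t) :
    blockEntropy q t ≤ blockEntropy q s := by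
  unfold blockEntropy
  refine div_le_div_of_nonneg_right (Finset.sum_le_sum fun ω _ => ?_)
    (mul_nonneg (Nat.cast_nonneg _) (Real.log_natCast_nonneg q))
  have hs : (0 : ℝ) < blockCard s ω := Nat.cast_pos.2 (blockCard_pos s ω)
  have ht : (0 : ℝ) < blockCard t ω := Nat.cast_pos.2 (blockCard_pos t ω)
  have hΩ : (0 : ℝ) < Fintype.card Ω := Nat.cast_pos.2 (Fintype.card_pos_iff.2 ⟨ω⟩)
  refine Real.log_le_log (by positivity) ?_
  exact div_le_div_of_nonneg_left hΩ.le hs (Nat.cast_le.2 (blockCard_mono h ω))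

/-- The numerator counts pairs `(x, y)` with `x` in the `s ⊓ r` block and `y` in the `t ⊓ r` block
of `ω`. After exchanging sums, the `ω` compatible with a fixed pair form one block of `s ⊓ t ⊓ r` or
nothing, which absorbs the first factor of the denominator. The second factor averages over the `r`
block of `x`. -/
lemma sum_blockCard_ratio_le (s t r : Setoid Ω) :
    ∑ ω, ((blockCard (s ⊓ r) ω : ℝ) * blockCard (t ⊓ r) ω)
      / (blockCard (s ⊓ t ⊓ r) ω * blockCard r ω) ≤ Fintype.card Ω := by
  classical
  have hind : ∀ (a : Setoid Ω) (ω : Ω),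
      (blockCard a ω : ℝ) = ∑ x : Ω, if a x ω then (1 : ℝ) else 0 := fun a ω => by
    simp [blockCard]
  have hpos : ∀ (a : Setoid Ω) (ω : Ω), (0 : ℝ) < blockCard a ω := fun a ω =>
    Nat.cast_pos.2 (blockCard_pos a ω)
  have hexp : ∀ ω, ((blockCard (s ⊓ r) ω : ℝ) * blockCard (t ⊓ r) ω)
      / (blockCard (s ⊓ t ⊓ r) ω * blockCard r ω)
      = ∑ x : Ω, ∑ y : Ω, if (s ⊓ r) x ω ∧ (t ⊓ r) y ω then
          ((blockCard (s ⊓ t ⊓ r) ω : ℝ) * blockCard r ω)⁻¹ else 0 := fun ω => by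
    rw [hind (s ⊓ r), hind (t ⊓ r), Finset.sum_mul_sum, div_eq_mul_inv, Finset.sum_mul]
    refine Finset.sum_congr rfl fun x _ => ?_
    rw [Finset.sum_mul]
    refine Finset.sum_congr rfl fun y _ => ?_
    by_cases h1 : (s ⊓ r) x ω <;> by_cases h2 : (t ⊓ r) y ω <;> simp [h1, h2]
  simp_rw [hexp]
  rw [Finset.sum_comm]
  have hinner : ∀ x y : Ω, (∑ ω, if (s ⊓ r) x ω ∧ (t ⊓ r) y ω then
      ((blockCard (s ⊓ t ⊓ r) ω : ℝ) * blockCard r ω)⁻¹ else 0)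
      ≤ if r y x then (blockCard r x : ℝ)⁻¹ else 0 := fun x y => by
    by_cases hex : ∃ ω, (s ⊓ r) x ω ∧ (t ⊓ r) y ω
    · obtain ⟨ω₀, h1, h2⟩ := hex
      rw [if_pos (r.trans' h2.2 (r.symm' h1.2))]
      have hiff : ∀ ω, ((s ⊓ r) x ω ∧ (t ⊓ r) y ω) ↔ (s ⊓ t ⊓ r) ω ω₀ := fun ω =>
        ⟨fun h => ⟨⟨s.trans' (s.symm' h.1.1) h1.1, t.trans' (t.symm' h.2.1) h2.1⟩,
          r.trans' (r.symm' h.1.2) h1.2⟩,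
        fun h => ⟨⟨s.trans' h1.1 (s.symm' h.1.1), r.trans' h1.2 (r.symm' h.2)⟩,
          ⟨t.trans' h2.1 (t.symm' h.1.2), r.trans' h2.2 (r.symm' h.2)⟩⟩⟩
      have : ∀ ω, (if (s ⊓ r) x ω ∧ (t ⊓ r) y ω then
          ((blockCard (s ⊓ t ⊓ r) ω : ℝ) * blockCard r ω)⁻¹ else 0)
          = (if (s ⊓ t ⊓ r) ω ω₀ then (1 : ℝ) else 0)
            * ((blockCard (s ⊓ t ⊓ r) ω₀ : ℝ) * blockCard r x)⁻¹ := fun ω => by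
        by_cases h : (s ⊓ t ⊓ r) ω ω₀
        · rw [if_pos ((hiff ω).2 h), if_pos h, one_mul, blockCard_congr _ h,
            blockCard_congr r (r.trans' h.2 (r.symm' h1.2))]
        · rw [if_neg (fun h' => h ((hiff ω).1 h')), if_neg h, zero_mul]
      simp_rw [this]
      rw [← Finset.sum_mul, ← hind, mul_inv, ← mul_assoc, mul_inv_cancel₀ (hpos _ _).ne', one_mul]
    · push Not at hex
      rw [Finset.sum_eq_zero fun ω _ => if_neg fun h => hex ω h.1 h.2]
      split_ifs
      · exact inv_nonneg.2 (hpos _ _).le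
      · exact le_rfl
  calc _ ≤ ∑ x : Ω, ∑ y : Ω, (if r y x then (blockCard r x : ℝ)⁻¹ else 0) := by
        refine Finset.sum_le_sum fun x _ => ?_
        rw [Finset.sum_comm]
        exact Finset.sum_le_sum fun y _ => hinner x y
    _ = ∑ x : Ω, (1 : ℝ) := by
        refine Finset.sum_congr rfl fun x _ => ?_
        rw [← mul_inv_cancel₀ (hpos r x).ne']
        nth_rewrite 2 [hind]
        rw [Finset.sum_mul]
        exact Finset.sum_congr rfl fun y _ => by split_ifs <;> simp
    _ = Fintype.card Ω := by simp

/-- Submodularity of the entropy. -/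
lemma blockEntropy_submodular (q : ℕ) (s t r : Setoid Ω) :
    blockEntropy q (s ⊓ t ⊓ r) + blockEntropy q r
      ≤ blockEntropy q (s ⊓ r) + blockEntropy q (t ⊓ r) := by
  unfold blockEntropy
  rw [← add_div, ← add_div]
  refine div_le_div_of_nonneg_right ?_
    (mul_nonneg (Nat.cast_nonneg _) (Real.log_natCast_nonneg q))
  rw [← Finset.sum_add_distrib, ← Finset.sum_add_distrib, ← sub_nonneg, ← Finset.sum_sub_distrib]
  have hpos : ∀ (a : Setoid Ω) (ω : Ω), (0 : ℝ) < blockCard a ω := fun a ω =>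
    Nat.cast_pos.2 (blockCard_pos a ω)
  have hterm : ∀ ω, 1 - ((blockCard (s ⊓ r) ω : ℝ) * blockCard (t ⊓ r) ω)
      / (blockCard (s ⊓ t ⊓ r) ω * blockCard r ω)
      ≤ Real.log ((Fintype.card Ω : ℝ) / blockCard (s ⊓ r) ω)
        + Real.log ((Fintype.card Ω : ℝ) / blockCard (t ⊓ r) ω)
        - (Real.log ((Fintype.card Ω : ℝ) / blockCard (s ⊓ t ⊓ r) ω)
        + Real.log ((Fintype.card Ω : ℝ) / blockCard r ω)) := fun ω => by
    have hΩ : (0 : ℝ) < Fintype.card Ω := Nat.cast_pos.2 (Fintype.card_pos_iff.2 ⟨ω⟩)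
    have h1 := hpos (s ⊓ r) ω
    have h2 := hpos (t ⊓ r) ω
    have h3 := hpos (s ⊓ t ⊓ r) ω
    have h4 := hpos r ω
    -- Gibbs' inequality: `1 - 1/z ≤ log z` at the inverse of the ratio bounded in
    -- `sum_blockCard_ratio_le`.
    have := Real.one_sub_inv_le_log_of_pos
      (x := ((blockCard (s ⊓ t ⊓ r) ω : ℝ) * blockCard r ω)
        / (blockCard (s ⊓ r) ω * blockCard (t ⊓ r) ω)) (by positivity)
    rw [inv_div, Real.log_div (by positivity) (by positivity),
      Real.log_mul h3.ne' h4.ne', Real.log_mul h1.ne' h2.ne'] at this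
    rw [Real.log_div hΩ.ne' h1.ne', Real.log_div hΩ.ne' h2.ne', Real.log_div hΩ.ne' h3.ne',
      Real.log_div hΩ.ne' h4.ne']
    linarith
  refine le_trans ?_ (Finset.sum_le_sum fun ω _ => hterm ω)
  rw [Finset.sum_sub_distrib]
  have := sum_blockCard_ratio_le s t r
  simp only [Finset.sum_const, Finset.card_univ, nsmul_eq_mul, mul_one]
  linarith

/-- A surjective additive homomorphism is uniformly distributed. -/
lemma blockEntropy_ker_of_surjective [AddGroup Ω] {α : Type*} [AddGroup α] (q : ℕ)
    (X : Ω →+ α) (hX : Function.Surjective X) :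
    blockEntropy q (Setoid.ker X) = Real.log (Nat.card α) / Real.log q := by
  classical
  have : Finite α := Finite.of_surjective X hX
  have : Fintype α := Fintype.ofFinite α
  have hcard : ∀ ω, blockCard (Setoid.ker X) ω * Fintype.card α = Fintype.card Ω := fun ω => by
    have h := Finset.card_eq_sum_card_fiberwise (f := X) (s := Finset.univ) (t := Finset.univ)
      (fun _ _ => by simp)
    rw [Finset.card_univ] at h
    rw [h, Finset.sum_congr rfl fun b _ =>
      AddMonoidHom.card_fiber_eq_of_mem_range X (hX b) (hX (X ω))]
    simp [blockCard, Setoid.ker_def, mul_comm]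
  have hΩ : (0 : ℝ) < Fintype.card Ω := Nat.cast_pos.2 (Fintype.card_pos_iff.2 ⟨0⟩)
  have hval : ∀ ω, (Fintype.card Ω : ℝ) / blockCard (Setoid.ker X) ω = Nat.card α := fun ω => by
    have hb : (0 : ℝ) < blockCard (Setoid.ker X) ω := Nat.cast_pos.2 (blockCard_pos _ ω)
    rw [Nat.card_eq_fintype_card, ← hcard ω]
    push_cast
    field_simp
  unfold blockEntropy
  simp_rw [hval]
  rw [Finset.sum_const, Finset.card_univ, nsmul_eq_mul, mul_div_mul_left _ _ hΩ.ne']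

end BlockEntropy

end SecureStorage

/-! ### Labels of edges, and codes as families of partitions -/

namespace SecureStorage

lemma StorageGraph.label_eq_of_mem {V : Type*} {K : ℕ} {G : StorageGraph V K}
    (hM : G.HasEdgeSize 1) {v w : V} (h : G.graph.Adj v w) {k : Fin K}
    (hk : k ∈ G.label s(v, w)) : G.label s(v, w) = {k} := by
  rcases hM s(v, w) h with h0 | h1
  · simp [h0] at hk
  · obtain ⟨j, hj⟩ := Finset.card_eq_one.1 h1
    rw [hj, Finset.mem_singleton] at hk
    rw [hj, hk]

lemma StorageGraph.mem_commonSources {V : Type*} {K : ℕ} {G : StorageGraph V K} {v : V}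
    {k : Fin K} : k ∈ G.commonSources v ↔ ∀ w, G.graph.Adj v w → k ∈ G.label s(v, w) := by
  simp [StorageGraph.commonSources]

lemma StorageGraph.commonSources_subset {V : Type*} {K : ℕ} {G : StorageGraph V K} {v w : V}
    (h : G.graph.Adj v w) : G.commonSources v ⊆ G.label s(v, w) := fun _ hk =>
  StorageGraph.mem_commonSources.1 hk w h

/-- A non-degenerate node has no common source symbols if every edge has at most one. -/
lemma StorageGraph.commonSources_eq_empty {V : Type*} {K : ℕ} {G : StorageGraph V K}
    (hM : G.HasEdgeSize 1) {v : V} (hv : v ∉ G.degenerateNodes) : G.commonSources v = ∅ := by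
  by_contra hne
  obtain ⟨k, hk⟩ := Finset.nonempty_iff_ne_empty.2 hne
  refine hv fun w hw => ?_
  have hl := StorageGraph.label_eq_of_mem hM hw (StorageGraph.mem_commonSources.1 hk w hw)
  refine subset_antisymm ?_ (StorageGraph.commonSources_subset hw)
  rw [hl]
  simpa using hk

/-- The projection onto the source symbols in `S`, as an additive homomorphism. -/
def sourcesHom {F : Type} [Field F] {K : ℕ} (L LZ : ℕ) (S : Finset (Fin K)) :
    Sample F K L LZ →+ (S → Fin L → F) where
  toFun := sources S
  map_zero' := rfl
  map_add' _ _ := rfl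

namespace StorageCode

variable {F : Type} {V : Type*} {K : ℕ}

/-- The partition of the sample space induced by the coded symbol of a node. -/
def node (c : StorageCode F V K) (v : V) : Setoid (Sample F K c.L c.LZ) :=
  Setoid.ker (c.enc v)

/-- The partition of the sample space induced by the source symbols in `S`. -/
def src (c : StorageCode F V K) (S : Finset (Fin K)) : Setoid (Sample F K c.L c.LZ) :=
  Setoid.ker (sources S)

/-- The entropy of a partition of the sample space, in field symbols. -/
noncomputable def ent [Fintype F] (c : StorageCode F V K) (s : Setoid (Sample F K c.L c.LZ)) : ℝ :=
  blockEntropy (Fintype.card F) s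

lemma src_apply (c : StorageCode F V K) (S : Finset (Fin K)) (x y : Sample F K c.L c.LZ) :
    c.src S x y ↔ ∀ k ∈ S, x.1 k = y.1 k := by
  change sources S x = sources S y ↔ _
  simp [sources, funext_iff]

lemma src_inf_src (c : StorageCode F V K) (S T : Finset (Fin K)) :
    c.src S ⊓ c.src T = c.src (S ∪ T) := by
  ext x y
  simp only [Setoid.inf_iff_and, src_apply, Finset.mem_union]
  exact ⟨fun h k hk => hk.elim (h.1 k) (h.2 k),
    fun h => ⟨fun k hk => h k (Or.inl hk), fun k hk => h k (Or.inr hk)⟩⟩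

lemma src_anti (c : StorageCode F V K) {S T : Finset (Fin K)} (h : S ⊆ T) :
    c.src T ≤ c.src S := fun x y hxy =>
  (c.src_apply S x y).2 fun k hk => (c.src_apply T x y).1 hxy k (h hk)

section Ent

variable [Fintype F] (c : StorageCode F V K)

lemma ent_anti {s t : Setoid (Sample F K c.L c.LZ)} (h : s ≤ t) : c.ent t ≤ c.ent s :=
  blockEntropy_anti h

lemma ent_submodular (s t r : Setoid (Sample F K c.L c.LZ)) :
    c.ent (s ⊓ t ⊓ r) + c.ent r ≤ c.ent (s ⊓ r) + c.ent (t ⊓ r) :=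
  blockEntropy_submodular _ s t r

end Ent

section Correct

variable [Fintype F] {c : StorageCode F V K} {G : StorageGraph V K}

lemma IsSecure.correct (hc : c.IsSecure G) {x y : V} (h : G.graph.Adj x y) :
    c.ent (c.src (G.label s(x, y)) ⊓ (c.node x ⊓ c.node y)) = c.ent (c.node x ⊓ c.node y) := by
  have h1 := (hc x y h).1
  rw [condEntropy, entropy_eq_blockEntropy, entropy_eq_blockEntropy, ker_pair, sub_eq_zero] at h1
  have : Setoid.ker (c.pair x y) = c.node x ⊓ c.node y := ker_pair _ _
  rw [this] at h1
  exact h1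

end Correct

variable [Field F] [Fintype F] (c : StorageCode F V K)

lemma log_card_pos (F : Type) [Field F] [Fintype F] : 0 < Real.log (Fintype.card F) :=
  Real.log_pos (Nat.one_lt_cast.2 Fintype.one_lt_card)

lemma ent_src (S : Finset (Fin K)) : c.ent (c.src S) = S.card * c.L := by
  have hsurj : Function.Surjective (sourcesHom (F := F) c.L c.LZ S) := fun y => by
    classical
    refine ⟨(fun k => if h : k ∈ S then y ⟨k, h⟩ else 0, 0), ?_⟩
    funext k
    exact dif_pos k.2
  have h := blockEntropy_ker_of_surjective (Fintype.card F) _ hsurj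
  have hl := log_card_pos F
  have hcard : Nat.card (S → Fin c.L → F) = Fintype.card F ^ (S.card * c.L) := by
    simp [Nat.card_eq_fintype_card, ← pow_mul, mul_comm]
  rw [hcard, Nat.cast_pow, Real.log_pow, mul_div_cancel_right₀ _ hl.ne'] at h
  exact_mod_cast h

lemma ent_bot : c.ent ⊥ = K * c.L + c.LZ := by
  have h := blockEntropy_ker_of_surjective (Fintype.card F)
    (AddMonoidHom.id (Sample F K c.L c.LZ)) Function.surjective_id
  have hker : Setoid.ker (AddMonoidHom.id (Sample F K c.L c.LZ)) = ⊥ := by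
    ext x y
    simp [Setoid.ker_def]
  have hl := log_card_pos F
  have hcard : Nat.card (Sample F K c.L c.LZ) = Fintype.card F ^ (K * c.L + c.LZ) := by
    rw [Nat.card_eq_fintype_card]
    simp [pow_add, ← pow_mul, mul_comm]
  rw [hker, hcard, Nat.cast_pow, Real.log_pow, mul_div_cancel_right₀ _ hl.ne'] at h
  exact_mod_cast h

lemma ent_top : c.ent ⊤ = 0 := by
  have h := c.ent_src ∅
  have : c.src ∅ = ⊤ := by
    ext x y
    simp [src_apply]
  simpa [this] using h

lemma ent_inf_le (s t : Setoid (Sample F K c.L c.LZ)) : c.ent (s ⊓ t) ≤ c.ent s + c.ent t := by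
  have h := c.ent_submodular s t ⊤
  simpa [c.ent_top] using h

/-! ### Converse: entropy bounds for secure codes -/

variable {c} {G : StorageGraph V K}

lemma IsSecure.secure (hc : c.IsSecure G) {x y : V} (h : G.graph.Adj x y) :
    c.ent (c.node x ⊓ c.node y ⊓ c.src (G.label s(x, y))) + K * c.L
      = (G.label s(x, y)).card * c.L + c.ent (c.node x ⊓ c.node y ⊓ c.src Finset.univ) := by
  have h1 := (hc x y h).2
  have hp : Setoid.ker (c.pair x y) = c.node x ⊓ c.node y := ker_pair _ _
  simp only [condMutualInfo, condEntropy, entropy_eq_blockEntropy, ker_pair, hp] at h1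
  change c.ent (c.node x ⊓ c.node y ⊓ c.src (G.label s(x, y))) - c.ent (c.src _)
    - (c.ent (c.node x ⊓ c.node y ⊓ (c.src (G.label s(x, y))ᶜ ⊓ c.src _))
      - c.ent (c.src _ ⊓ c.src _)) = 0 at h1
  rw [src_inf_src, Finset.union_comm, Finset.union_compl, ent_src, ent_src,
    Finset.card_univ, Fintype.card_fin] at h1
  linarith

/-- Each end of an edge is conditionally independent of the other source symbols. -/
lemma IsSecure.node_secure (hc : c.IsSecure G) {x y : V} (h : G.graph.Adj x y) :
    c.ent (c.node x ⊓ c.src (G.label s(x, y))) + K * c.L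
      ≤ (G.label s(x, y)).card * c.L + c.ent (c.node x ⊓ c.src Finset.univ) := by
  have h1 := hc.secure h
  have h2 := c.ent_submodular (c.node y) (c.src Finset.univ)
    (c.node x ⊓ c.src (G.label s(x, y)))
  have e1 : c.node y ⊓ c.src Finset.univ ⊓ (c.node x ⊓ c.src (G.label s(x, y)))
      = c.node x ⊓ c.node y ⊓ c.src Finset.univ := by
    have := inf_eq_left.2 (c.src_anti (Finset.subset_univ (G.label s(x, y))))
    rw [← this]; ac_rfl
  have e2 : c.src Finset.univ ⊓ (c.node x ⊓ c.src (G.label s(x, y)))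
      = c.node x ⊓ c.src Finset.univ := by
    have := inf_eq_left.2 (c.src_anti (Finset.subset_univ (G.label s(x, y))))
    rw [← this]; ac_rfl
  have e3 : c.node y ⊓ (c.node x ⊓ c.src (G.label s(x, y)))
      = c.node x ⊓ c.node y ⊓ c.src (G.label s(x, y)) := by ac_rfl
  rw [e1, e2, e3] at h2
  linarith

/-- Conditioning reduces entropy, `H(s | W_T) ≤ H(s | W_S)`, with the source entropies evaluated. -/
lemma ent_inf_src_le (s : Setoid (Sample F K c.L c.LZ)) {S T : Finset (Fin K)} (h : S ⊆ T) :
    c.ent (s ⊓ c.src T) + S.card * c.L ≤ c.ent (s ⊓ c.src S) + T.card * c.L := by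
  have h1 := c.ent_submodular s (c.src T) (c.src S)
  rw [inf_assoc, inf_eq_left.2 (c.src_anti h), ent_src, ent_src] at h1
  exact h1

/-- A node with an edge labelled `{k}` and an edge whose label does not contain `k` stores a symbol
that is independent of all source symbols. -/
lemma IsSecure.node_indep (hc : c.IsSecure G) {x y y' : V} {k : Fin K} (h : G.graph.Adj x y)
    (hk : G.label s(x, y) = {k}) (h' : G.graph.Adj x y') (hk' : k ∉ G.label s(x, y')) :
    c.ent (c.node x) + K * c.L ≤ c.ent (c.node x ⊓ c.src Finset.univ) := by
  have h1 := hc.node_secure h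
  have h2 := hc.node_secure h'
  rw [hk, Finset.card_singleton] at h1
  have hsub : G.label s(x, y') ⊆ {k}ᶜ := fun j hj => by
    simp only [Finset.mem_compl, Finset.mem_singleton]
    rintro rfl
    exact hk' hj
  have h3 := ent_inf_src_le (c.node x) hsub
  -- Given the node, `H(W) ≤ H(W_k) + H(W_{kᶜ})`. The first edge bounds `H(V_x | W_k)` by `H(V_x |
  -- W)`, and the second does the same for `H(V_x | W_{kᶜ})`. Together these give independence.
  have h4 := c.ent_submodular (c.src {k}) (c.src {k}ᶜ) (c.node x)
  rw [src_inf_src, Finset.union_compl, inf_comm, inf_comm (c.src {k}), inf_comm (c.src {k}ᶜ)] at h4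
  have hcard : ((({k}ᶜ : Finset (Fin K)).card : ℕ) : ℝ) = K - 1 := by
    rw [Finset.card_compl, Fintype.card_fin, Finset.card_singleton,
      Nat.cast_sub (by have := k.2; omega), Nat.cast_one]
  rw [hcard] at h3
  push_cast at h1 h2
  linarith

lemma IsSecure.core_indep (hM : G.HasEdgeSize 1) (hc : c.IsSecure G) {x : V}
    (hx : x ∈ G.coreNodes) :
    c.ent (c.node x) + K * c.L ≤ c.ent (c.node x ⊓ c.src Finset.univ) := by
  obtain ⟨hd, y, -, hxy, hne⟩ := hx
  obtain ⟨k, hk⟩ := Finset.nonempty_iff_ne_empty.2 hne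
  have hC := StorageGraph.commonSources_eq_empty hM hd
  have hk' : k ∉ G.commonSources x := by simp [hC]
  rw [StorageGraph.mem_commonSources] at hk'
  push Not at hk'
  obtain ⟨y', h', hy'⟩ := hk'
  exact hc.node_indep hxy (StorageGraph.label_eq_of_mem hM hxy hk) h' hy'

lemma ent_node_le_key {x : V}
    (hx : c.ent (c.node x) + K * c.L ≤ c.ent (c.node x ⊓ c.src Finset.univ)) :
    c.ent (c.node x) ≤ c.LZ := by
  have h1 := c.ent_anti (bot_le (a := c.node x ⊓ c.src Finset.univ))
  rw [ent_bot] at h1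
  linarith

lemma ent_node_inf_src_ge {x : V}
    (hx : c.ent (c.node x) + K * c.L ≤ c.ent (c.node x ⊓ c.src Finset.univ))
    (S : Finset (Fin K)) : c.ent (c.node x) + S.card * c.L ≤ c.ent (c.node x ⊓ c.src S) := by
  have h1 := ent_inf_src_le (c.node x) (Finset.subset_univ S)
  rw [Finset.card_univ, Fintype.card_fin] at h1
  linarith

/-- The neighbour `y` is also in the core, so `V_y` says nothing about `W_k`. The pair determines
`W_k`, so `V_x` must supply the missing `L` symbols. -/
lemma IsSecure.le_ent_core (hM : G.HasEdgeSize 1) (hc : c.IsSecure G) {x : V}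
    (hx : x ∈ G.coreNodes) : (c.L : ℝ) ≤ c.ent (c.node x) := by
  obtain ⟨hd, y, hy, hxy, hne⟩ := hx
  obtain ⟨k, hk⟩ := Finset.nonempty_iff_ne_empty.2 hne
  have hyc : y ∈ G.coreNodes := ⟨hy, x, hd, hxy.symm, by rwa [Sym2.eq_swap]⟩
  have h1 := ent_node_inf_src_ge (hc.core_indep hM hyc) {k}
  have h2 := hc.correct hxy
  rw [StorageGraph.label_eq_of_mem hM hxy hk] at h2
  have h3 : c.ent (c.node y ⊓ c.src {k}) ≤ c.ent (c.src {k} ⊓ (c.node x ⊓ c.node y)) :=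
    c.ent_anti (le_inf (inf_le_right.trans inf_le_right) inf_le_left)
  have h4 := c.ent_inf_le (c.node x) (c.node y)
  rw [Finset.card_singleton, Nat.cast_one] at h1
  linarith

lemma IsSecure.length_le_key (hM : G.HasEdgeSize 1) (hc : c.IsSecure G)
    (hG : G.coreNodes.Nonempty) : c.L ≤ c.LZ := by
  obtain ⟨x, hx⟩ := hG
  exact_mod_cast (hc.le_ent_core hM hx).trans (ent_node_le_key (hc.core_indep hM hx))

/-- Across an edge whose label does not contain `k`, the coded symbols of two core nodes determine
each other up to `LZ - L` field symbols, given the source symbols other than `k`. -/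
lemma IsSecure.ent_step (hM : G.HasEdgeSize 1) (hc : c.IsSecure G) {x y : V}
    (hx : x ∈ G.coreNodes) (h : G.graph.Adj x y) {k : Fin K} (hk : k ∉ G.label s(x, y)) :
    c.ent (c.node x ⊓ c.node y ⊓ c.src {k}ᶜ) + c.L ≤ c.ent (c.node x ⊓ c.src {k}ᶜ) + c.LZ := by
  have hsub : G.label s(x, y) ⊆ {k}ᶜ := fun j hj => by
    simp only [Finset.mem_compl, Finset.mem_singleton]
    rintro rfl
    exact hk hj
  have h1 := hc.secure h
  have h2 := c.ent_anti (bot_le (a := c.node x ⊓ c.node y ⊓ c.src Finset.univ))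
  rw [ent_bot] at h2
  have h3 := ent_node_inf_src_ge (hc.core_indep hM hx) (G.label s(x, y))
  have h4 := hc.le_ent_core hM hx
  -- Given the label's sources, security and the key size bound the pair by `LZ`, of which `V_x`
  -- alone takes at least `L`. Conditioning on the further sources in `{k}ᶜ` only lowers what is
  -- left for `V_y`.
  have h5 := c.ent_submodular (c.node y) (c.src {k}ᶜ) (c.node x ⊓ c.src (G.label s(x, y)))
  have e0 := inf_eq_left.2 (c.src_anti hsub)
  have e1 : c.node y ⊓ c.src {k}ᶜ ⊓ (c.node x ⊓ c.src (G.label s(x, y)))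
      = c.node x ⊓ c.node y ⊓ c.src {k}ᶜ := by
    rw [← e0]; ac_rfl
  have e2 : c.src {k}ᶜ ⊓ (c.node x ⊓ c.src (G.label s(x, y))) = c.node x ⊓ c.src {k}ᶜ := by
    rw [← e0]; ac_rfl
  have e3 : c.node y ⊓ (c.node x ⊓ c.src (G.label s(x, y)))
      = c.node x ⊓ c.node y ⊓ c.src (G.label s(x, y)) := by ac_rfl
  rw [e1, e2, e3] at h5
  linarith

/-- Chain rule along the path, each edge costing at most `LZ - L`. Every intermediate node must lie
in the core for `IsSecure.ent_step` to apply, which is why the walk lives in the core. -/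
lemma IsSecure.ent_walk (hM : G.HasEdgeSize 1) (hc : c.IsSecure G) {k : Fin K}
    {x y : G.coreNodes} (p : (G.core.charGraph k).unqualifiedGraph.Walk x y) :
    c.ent (c.node x ⊓ c.node y ⊓ c.src {k}ᶜ) + p.length * c.L
      ≤ c.ent (c.node y ⊓ c.src {k}ᶜ) + p.length * c.LZ := by
  induction p with
  | nil => simp
  | @cons x z y hadj p ih =>
    have hxz : G.graph.Adj z x := hadj.1.symm
    have hk : k ∉ G.label s((z : V), (x : V)) := fun hmem => by
      have h0 : (if k ∈ G.label (Sym2.map Subtype.val s(x, z)) then ({k} : Finset (Fin K)) else ∅)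
        = ∅ := hadj.2
      rw [Sym2.map_mk, Sym2.eq_swap] at h0
      simp [hmem] at h0
    have h1 := hc.ent_step hM z.2 hxz hk
    have h2 := c.ent_submodular (c.node x) (c.node y) (c.node z ⊓ c.src {k}ᶜ)
    have h3 : c.ent (c.node x ⊓ c.node y ⊓ c.src {k}ᶜ)
        ≤ c.ent (c.node x ⊓ c.node y ⊓ (c.node z ⊓ c.src {k}ᶜ)) :=
      c.ent_anti (inf_le_inf_left _ inf_le_right)
    have e1 : c.node x ⊓ (c.node z ⊓ c.src {k}ᶜ) = c.node z ⊓ c.node x ⊓ c.src {k}ᶜ := by ac_rfl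
    have e2 : c.node y ⊓ (c.node z ⊓ c.src {k}ᶜ) = c.node z ⊓ c.node y ⊓ c.src {k}ᶜ := by ac_rfl
    rw [e1, e2] at h2
    rw [SimpleGraph.Walk.length_cons]
    push_cast
    linarith

/-- An internal qualified edge whose ends are joined by an unqualified path with `n` edges forces
`L ≤ n (LZ - L)`. -/
lemma IsSecure.length_le_of_walk (hM : G.HasEdgeSize 1) (hc : c.IsSecure G) {k : Fin K}
    {x y : G.coreNodes} (hxy : G.graph.Adj x y) (hk : k ∈ G.label s((x : V), (y : V)))
    (p : (G.core.charGraph k).unqualifiedGraph.Walk x y) :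
    c.L + p.length * c.L ≤ p.length * c.LZ := by
  have h1 := hc.ent_walk hM p
  have h2 := hc.core_indep hM y.2
  have h3 := hc.correct hxy
  rw [StorageGraph.label_eq_of_mem hM hxy hk] at h3
  -- `V_y` is independent of all sources, so `W_k` stays uniform given `V_y` and the other sources.
  -- Adding `V_x` reveals it, so `V_x` has conditional entropy at least `L`.
  have h4 := c.ent_submodular (c.src {k}) (c.src {k}ᶜ) (c.node x ⊓ c.node y)
  rw [src_inf_src, Finset.union_compl, h3, inf_comm (c.src {k}ᶜ)] at h4
  have h5 : c.ent (c.node y ⊓ c.src Finset.univ)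
      ≤ c.ent (c.src Finset.univ ⊓ (c.node x ⊓ c.node y)) :=
    c.ent_anti (le_inf (inf_le_right.trans inf_le_right) inf_le_left)
  have h6 := c.ent_inf_le (c.node y) (c.src {k}ᶜ)
  have hcard : ((({k}ᶜ : Finset (Fin K)).card : ℕ) : ℝ) = K - 1 := by
    rw [Finset.card_compl, Fintype.card_fin, Finset.card_singleton,
      Nat.cast_sub (by have := k.2; omega), Nat.cast_one]
  rw [ent_src, hcard] at h6
  have : (c.L : ℝ) + p.length * c.L ≤ p.length * c.LZ := by linarith
  exact_mod_cast this

end StorageCode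

end SecureStorage

/-! ### Achievability: linear codes -/

namespace SecureStorage

/-- A linear combination of the source symbols and of the key, where `φ` and `ψ` embed the source
symbols and the key into a field `E`. -/
noncomputable def linearHom {F E : Type} [Field F] [Field E] {K L LZ : ℕ}
    (φ : (Fin L → F) →+ E) (ψ : (Fin LZ → F) →+ E) (a : Fin K → E) : Sample F K L LZ →+ E where
  toFun ω := ∑ k, a k * φ (ω.1 k) + ψ ω.2
  map_zero' := by simp
  map_add' x y := by
    simp only [Prod.fst_add, Prod.snd_add, Pi.add_apply, map_add, mul_add, Finset.sum_add_distrib]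
    ring

open Classical in
/-- The linear code in which the core nodes store padded linear combinations of the source symbols,
and any other node stores the sum of its common source symbols. -/
noncomputable def linearCode {F E : Type} [Field F] [Field E] {V : Type*} {K L LZ : ℕ}
    (G : StorageGraph V K) (hL : 0 < L) (φ : (Fin L → F) →+ E) (ψ : (Fin LZ → F) →+ E)
    (u : Fin K → G.coreNodes → E) : StorageCode F V K where
  L := L
  LZ := LZ
  L_pos := hL
  alphabet _ := E
  enc v ω := if h : v ∈ G.coreNodes then linearHom φ ψ (fun k => u k ⟨v, h⟩) ω
    else ∑ k ∈ G.commonSources v, φ (ω.1 k)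

namespace StorageCode

variable {F : Type} [Field F] [Fintype F] {V : Type*} {K : ℕ}

/-- One-time pad: for fixed sources the key alone sweeps out `E`, so the symbol and the sources are
jointly uniform on the product. -/
lemma ent_ker_inf_src {E : Type} [AddGroup E] (c : StorageCode F V K)
    (T : Sample F K c.L c.LZ →+ E) (hT : ∀ W e, ∃ z, T (W, z) = e) (S : Finset (Fin K)) :
    c.ent (Setoid.ker T ⊓ c.src S)
      = Real.log (Nat.card E) / Real.log (Fintype.card F) + S.card * c.L := by
  have hsurj : Function.Surjective (T.prod (sourcesHom (F := F) c.L c.LZ S)) := fun y => by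
    classical
    obtain ⟨z, hz⟩ := hT (fun k => if h : k ∈ S then y.2 ⟨k, h⟩ else 0) y.1
    refine ⟨(fun k => if h : k ∈ S then y.2 ⟨k, h⟩ else 0, z), Prod.ext hz ?_⟩
    funext k
    exact dif_pos k.2
  have : Finite E := Finite.of_surjective (fun z => T (0, z)) (hT 0)
  have h := blockEntropy_ker_of_surjective (Fintype.card F) _ hsurj
  have hl := log_card_pos F
  have hcard : Nat.card (S → Fin c.L → F) = Fintype.card F ^ (S.card * c.L) := by
    simp [Nat.card_eq_fintype_card, ← pow_mul, mul_comm]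
  have hE : (Nat.card E : ℝ) ≠ 0 := Nat.cast_ne_zero.2 Nat.card_pos.ne'
  have hF : (Fintype.card F : ℝ) ≠ 0 := Nat.cast_ne_zero.2 Fintype.card_ne_zero
  rw [Nat.card_prod, hcard, Nat.cast_mul, Nat.cast_pow, Real.log_mul hE (pow_ne_zero _ hF),
    Real.log_pow, add_div, mul_div_cancel_right₀ _ hl.ne'] at h
  have hker : Setoid.ker (T.prod (sourcesHom (F := F) c.L c.LZ S)) = Setoid.ker T ⊓ c.src S :=
    ker_pair _ _
  rw [hker] at h
  exact_mod_cast h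

/-- The number `a` is the entropy of the pair given `W_S`. It is the same for the label and for the
full set of sources, so the mutual information vanishes. -/
lemma isSecure_of_ent (c : StorageCode F V K) (G : StorageGraph V K)
    (h : ∀ x y, G.graph.Adj x y → c.node x ⊓ c.node y ≤ c.src (G.label s(x, y)) ∧
      ∃ a : ℝ, ∀ S, G.label s(x, y) ⊆ S →
        c.ent (c.node x ⊓ c.node y ⊓ c.src S) = a + S.card * c.L) : c.IsSecure G := by
  intro x y hxy
  obtain ⟨hcorr, a, ha⟩ := h x y hxy
  have hp : Setoid.ker (c.pair x y) = c.node x ⊓ c.node y := ker_pair _ _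
  constructor
  · rw [condEntropy, entropy_eq_blockEntropy, entropy_eq_blockEntropy, ker_pair, hp, sub_eq_zero]
    exact congrArg c.ent (inf_eq_right.2 hcorr)
  · simp only [condMutualInfo, condEntropy, entropy_eq_blockEntropy, ker_pair, hp]
    change c.ent (c.node x ⊓ c.node y ⊓ c.src (G.label s(x, y))) - c.ent (c.src _)
      - (c.ent (c.node x ⊓ c.node y ⊓ (c.src (G.label s(x, y))ᶜ ⊓ c.src _))
        - c.ent (c.src _ ⊓ c.src _)) = 0
    rw [src_inf_src, Finset.union_comm, Finset.union_compl, ent_src, ent_src,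
      ha _ subset_rfl, ha _ (Finset.subset_univ _)]
    ring

end StorageCode

section LinearCode

open StorageCode

variable {F E : Type} [Field F] [Field E] {V : Type*} {K L LZ : ℕ}
  {G : StorageGraph V K} {hL : 0 < L} {φ : (Fin L → F) →+ E} {ψ : (Fin LZ → F) →+ E}
  {u : Fin K → G.coreNodes → E}

lemma linearHom_surjective (hψ : Function.Surjective ψ) (a : Fin K → E)
    (W : Fin K → Fin L → F) (e : E) : ∃ z, linearHom φ ψ a (W, z) = e := by
  obtain ⟨z, hz⟩ := hψ (e - ∑ k, a k * φ (W k))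
  exact ⟨z, by simp [linearHom, hz]⟩

lemma linearHom_add_sum {a b : Fin K → E} {M : Finset (Fin K)} (h : ∀ k ∉ M, a k = b k)
    (ω : Sample F K L LZ) :
    linearHom φ ψ b ω = linearHom φ ψ a ω + ∑ k ∈ M, (b k - a k) * φ (ω.1 k) := by
  have : ∑ k ∈ M, (b k - a k) * φ (ω.1 k) = ∑ k, (b k - a k) * φ (ω.1 k) :=
    Finset.sum_subset (Finset.subset_univ M) fun k _ hk => by rw [h k hk, sub_self, zero_mul]
  rw [this]
  simp only [linearHom, AddMonoidHom.coe_mk, ZeroHom.coe_mk, sub_mul, Finset.sum_sub_distrib]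
  ring

lemma linearCode_node_core {v : V} (hv : v ∈ G.coreNodes) :
    (linearCode G hL φ ψ u).node v = Setoid.ker (linearHom φ ψ fun k => u k ⟨v, hv⟩) := by
  have : (linearCode G hL φ ψ u).enc v = linearHom φ ψ fun k => u k ⟨v, hv⟩ :=
    funext fun ω => dif_pos hv
  rw [node, this]
  rfl

lemma linearCode_node_of_notMem {v : V} (hv : v ∉ G.coreNodes) :
    (linearCode G hL φ ψ u).node v
      = Setoid.ker fun ω : Sample F K L LZ => ∑ k ∈ G.commonSources v, φ (ω.1 k) := by
  have : (linearCode G hL φ ψ u).enc v = fun ω => ∑ k ∈ G.commonSources v, φ (ω.1 k) :=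
    funext fun ω => dif_neg hv
  rw [node, this]
  rfl

lemma src_le_linearCode_node {x y : V} (hx : x ∉ G.coreNodes) (h : G.graph.Adj x y) :
    (linearCode G hL φ ψ u).src (G.label s(x, y)) ≤ (linearCode G hL φ ψ u).node x := by
  intro ω ω' hω
  rw [linearCode_node_of_notMem hx]
  rw [src_apply] at hω
  exact Finset.sum_congr rfl fun k hk =>
    congrArg φ (hω k (StorageGraph.commonSources_subset h hk))

lemma linearCode_node_le_src (hM : G.HasEdgeSize 1) (hφ : Function.Injective φ) {x y : V}
    (hx : x ∈ G.degenerateNodes) (h : G.graph.Adj x y) :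
    (linearCode G hL φ ψ u).node x ≤ (linearCode G hL φ ψ u).src (G.label s(x, y)) := by
  intro ω ω' hω
  rw [linearCode_node_of_notMem fun hx' => hx'.1 hx, ← hx y h] at hω
  change ∑ k ∈ G.label s(x, y), φ (ω.1 k) = ∑ k ∈ G.label s(x, y), φ (ω'.1 k) at hω
  rw [src_apply]
  intro k hk
  rw [StorageGraph.label_eq_of_mem hM h hk, Finset.sum_singleton, Finset.sum_singleton] at hω
  exact hφ hω

variable [Fintype F]

/-- The symbol at `x` is a function of the label's sources, so it leaks nothing further. A
degenerate end reveals the label. If neither end is degenerate, the edge is unqualified, since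
otherwise `x` would be in the core. Surjectivity of `ψ` is asked only for a nonempty core, so that
codes without a key are covered. -/
lemma linearCode_edge_of_notMem (hM : G.HasEdgeSize 1) (hφ : Function.Injective φ)
    (hψ : G.coreNodes.Nonempty → Function.Surjective ψ) {x y : V} (h : G.graph.Adj x y)
    (hx : x ∉ G.coreNodes) :
    (linearCode G hL φ ψ u).node x ⊓ (linearCode G hL φ ψ u).node y
        ≤ (linearCode G hL φ ψ u).src (G.label s(x, y)) ∧
      ∃ a : ℝ, ∀ S, G.label s(x, y) ⊆ S →
        (linearCode G hL φ ψ u).ent ((linearCode G hL φ ψ u).node x ⊓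
          (linearCode G hL φ ψ u).node y ⊓ (linearCode G hL φ ψ u).src S)
          = a + S.card * (linearCode G hL φ ψ u).L := by
  set c := linearCode G hL φ ψ u
  have hsx : c.src (G.label s(x, y)) ≤ c.node x := src_le_linearCode_node hx h
  have hswap : G.label s(y, x) = G.label s(x, y) := by rw [Sym2.eq_swap]
  constructor
  · by_cases hdx : x ∈ G.degenerateNodes
    · exact inf_le_left.trans (linearCode_node_le_src hM hφ hdx h)
    by_cases hdy : y ∈ G.degenerateNodes
    · have := linearCode_node_le_src (hL := hL) (ψ := ψ) (u := u) hM hφ hdy h.symm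
      rw [hswap] at this
      exact inf_le_right.trans this
    · have h0 : G.label s(x, y) = ∅ := by
        by_contra hne
        exact hx ⟨hdx, y, hdy, h, hne⟩
      intro ω ω' _
      rw [src_apply, h0]
      simp
  · by_cases hy : y ∈ G.coreNodes
    · refine ⟨Real.log (Nat.card E) / Real.log (Fintype.card F), fun S hS => ?_⟩
      rw [inf_comm (c.node x), inf_assoc, inf_eq_right.2 ((c.src_anti hS).trans hsx),
        show c.node y = _ from linearCode_node_core hy]
      exact c.ent_ker_inf_src _ (linearHom_surjective (hψ ⟨y, hy⟩) _) S
    · refine ⟨0, fun S hS => ?_⟩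
      have hsy := src_le_linearCode_node (hL := hL) (φ := φ) (ψ := ψ) (u := u) hy h.symm
      rw [hswap] at hsy
      rw [inf_eq_right.2 (le_inf ((c.src_anti hS).trans hsx) ((c.src_anti hS).trans hsy)),
        ent_src, zero_add]

/-- On a core edge the two symbols differ by at most one term, a nonzero multiple of `φ W_k` with
`k` the label. Hence the pair determines `W_k`. Conversely, given the label's sources, one symbol
determines the other, so the pair behaves like a single padded symbol. -/
lemma linearCode_isSecure (hM : G.HasEdgeSize 1) (hφ : Function.Injective φ)
    (hψ : G.coreNodes.Nonempty → Function.Surjective ψ)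
    (hu : ∀ k (x y : G.coreNodes), G.graph.Adj x y →
      (k ∈ G.label s((x : V), (y : V)) ↔ u k x ≠ u k y)) :
    (linearCode G hL φ ψ u).IsSecure G := by
  refine isSecure_of_ent _ _ fun x y h => ?_
  by_cases hx : x ∈ G.coreNodes
  swap
  · exact linearCode_edge_of_notMem hM hφ hψ h hx
  by_cases hy : y ∈ G.coreNodes
  swap
  · rw [inf_comm, Sym2.eq_swap]
    exact linearCode_edge_of_notMem hM hφ hψ h.symm hy
  have hu' := fun k => hu k ⟨x, hx⟩ ⟨y, hy⟩ h
  have hdiff := linearHom_add_sum (φ := φ) (ψ := ψ) (M := G.label s(x, y))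
    (a := fun k => u k ⟨x, hx⟩) (b := fun k => u k ⟨y, hy⟩)
    fun k hk => not_not.1 fun hne => hk ((hu' k).2 hne)
  constructor
  · intro (ω : Sample F K L LZ) (ω' : Sample F K L LZ) hω
    rw [linearCode_node_core hx, linearCode_node_core hy] at hω
    obtain ⟨h1, h2⟩ := hω
    change linearHom φ ψ _ ω = linearHom φ ψ _ ω' at h1
    change linearHom φ ψ _ ω = linearHom φ ψ _ ω' at h2
    rw [hdiff, hdiff, h1, add_right_inj] at h2
    refine (src_apply (linearCode G hL φ ψ u) _ ω ω').2 fun k hk => ?_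
    have hne := (hu' k).1 hk
    rw [StorageGraph.label_eq_of_mem hM h hk, Finset.sum_singleton, Finset.sum_singleton] at h2
    exact hφ (mul_left_cancel₀ (sub_ne_zero.2 hne.symm) h2)
  · refine ⟨Real.log (Nat.card E) / Real.log (Fintype.card F), fun S hS => ?_⟩
    rw [show (linearCode G hL φ ψ u).node x ⊓ (linearCode G hL φ ψ u).node y
        ⊓ (linearCode G hL φ ψ u).src S
        = Setoid.ker (linearHom φ ψ fun k => u k ⟨x, hx⟩) ⊓ (linearCode G hL φ ψ u).src S from ?_]
    · exact ent_ker_inf_src _ _ (linearHom_surjective (hψ ⟨x, hx⟩) _) S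
    · rw [linearCode_node_core hx, linearCode_node_core hy]
      refine le_antisymm (inf_le_inf_right _ inf_le_left) (le_inf (le_inf inf_le_left ?_)
        inf_le_right)
      intro (ω : Sample F K L LZ) (ω' : Sample F K L LZ) hω
      obtain ⟨h1, h2⟩ := hω
      change linearHom φ ψ _ ω = linearHom φ ψ _ ω' at h1
      change linearHom φ ψ _ ω = linearHom φ ψ _ ω'
      rw [hdiff, hdiff, h1]
      have h2 := (src_apply (linearCode G hL φ ψ u) _ ω ω').1 h2
      rw [Finset.sum_congr rfl fun k hk => by rw [h2 k (hS hk)]]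

end LinearCode

end SecureStorage

/-! ### Characteristic graphs and unqualified components -/

namespace SecureStorage

namespace StorageGraph

variable {V : Type*} {K : ℕ}

lemma charGraph_unqualifiedGraph_adj {H : StorageGraph V K} {k : Fin K} {v w : V} :
    (H.charGraph k).unqualifiedGraph.Adj v w ↔ H.graph.Adj v w ∧ k ∉ H.label s(v, w) := by
  simp [unqualifiedGraph, charGraph]

lemma charGraph_qualifiedAdj {H : StorageGraph V K} {k : Fin K} {v w : V} :
    (H.charGraph k).QualifiedAdj v w ↔ H.graph.Adj v w ∧ k ∈ H.label s(v, w) := by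
  simp [QualifiedAdj, charGraph]

/-- Injective coefficients of the unqualified components separate the ends of the edges whose label
contains `k` exactly when there is no internal qualified edge. -/
lemma mem_label_iff_coeff_ne {E : Type*} {H : StorageGraph V K} {k : Fin K}
    (hH : ¬ (H.charGraph k).HasInternalQualifiedEdge)
    {u : (H.charGraph k).unqualifiedGraph.ConnectedComponent → E} (hu : Function.Injective u)
    {v w : V} (h : H.graph.Adj v w) :
    k ∈ H.label s(v, w) ↔ u ((H.charGraph k).unqualifiedGraph.connectedComponentMk v)
      ≠ u ((H.charGraph k).unqualifiedGraph.connectedComponentMk w) := by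
  constructor
  · intro hk heq
    exact hH ⟨v, w, charGraph_qualifiedAdj.2 ⟨h, hk⟩,
      SimpleGraph.ConnectedComponent.eq.1 (hu heq)⟩
  · intro hne
    by_contra hk
    exact hne (congrArg u (SimpleGraph.ConnectedComponent.eq.2
      (charGraph_unqualifiedGraph_adj.2 ⟨h, hk⟩).reachable))

/-- A non-degenerate node has no common sources, so an edge that violates degeneracy there has a
nonempty label. -/
lemma coreNodes_eq_univ {G : StorageGraph V K} (hM : G.HasEdgeSize 1)
    (hG : G.degenerateNodes = ∅) : G.coreNodes = Set.univ := by
  refine Set.eq_univ_of_forall fun v => ?_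
  have hv : ∀ w, w ∉ G.degenerateNodes := fun w => by simp [hG]
  refine ⟨hv v, ?_⟩
  have h : ¬ ∀ w, G.graph.Adj v w → G.label s(v, w) = G.commonSources v := hv v
  push Not at h
  obtain ⟨w, hw, hne⟩ := h
  rw [commonSources_eq_empty hM (hv v)] at hne
  exact ⟨w, hv w, hw, hne⟩

lemma hasInternalQualifiedEdge_induce_iff {G : StorageGraph V K} {S : Set V} (hS : S = Set.univ)
    (k : Fin K) : ((G.induce S).charGraph k).HasInternalQualifiedEdge
      ↔ (G.charGraph k).HasInternalQualifiedEdge := by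
  constructor
  · rintro ⟨v, w, hq, hr⟩
    rw [charGraph_qualifiedAdj] at hq
    let f : ((G.induce S).charGraph k).unqualifiedGraph →g (G.charGraph k).unqualifiedGraph :=
      ⟨Subtype.val, fun {a b} hab => by
        rw [charGraph_unqualifiedGraph_adj] at hab ⊢
        exact hab⟩
    exact ⟨v, w, charGraph_qualifiedAdj.2 hq, hr.map f⟩
  · rintro ⟨v, w, hq, hr⟩
    rw [charGraph_qualifiedAdj] at hq
    have hmem : ∀ x, x ∈ S := fun x => hS ▸ Set.mem_univ x
    let f : (G.charGraph k).unqualifiedGraph →g ((G.induce S).charGraph k).unqualifiedGraph :=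
      ⟨fun x => ⟨x, hmem x⟩, fun {a b} hab => by
        rw [charGraph_unqualifiedGraph_adj] at hab ⊢
        exact hab⟩
    exact ⟨⟨v, hmem v⟩, ⟨w, hmem w⟩, charGraph_qualifiedAdj.2 hq, hr.map f⟩

end StorageGraph

/-! ### The capacity and the scalar code -/

section Capacity

variable {V : Type*} {K : ℕ} {G : StorageGraph V K} {Q : Set ℕ}

lemma exists_finite_field {q : ℕ} (hq : IsPrimePow q) :
    ∃ (p : ℕ) (_ : Fact p.Prime) (F : Type) (_ : Field F) (_ : Fintype F) (_ : CharP F p),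
      Fintype.card F = q := by
  obtain ⟨p, n, hp, hn, rfl⟩ := (isPrimePow_nat_iff q).1 hq
  have : Fact p.Prime := ⟨hp⟩
  refine ⟨p, ⟨hp⟩, GaloisField p n, inferInstance, Fintype.ofFinite _, inferInstance, ?_⟩
  rw [Fintype.card_eq_nat_card, GaloisField.card p n hn.ne']

lemma le_sourceKeyCapacity {F : Type} [Field F] [Fintype F] (hF : Fintype.card F ∈ Q)
    (c : StorageCode F V K) (hc : c.IsSecure G) : c.rate ≤ sourceKeyCapacity Q G := by
  unfold sourceKeyCapacity
  apply le_sSup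
  rw [Set.mem_ofPred_eq]
  refine ⟨F, inferInstance, inferInstance, hF, c, hc, rfl⟩

lemma sourceKeyCapacity_le_one (hM : G.HasEdgeSize 1) (hG : G.coreNodes.Nonempty) :
    sourceKeyCapacity Q G ≤ 1 := by
  refine sSup_le ?_
  rintro r ⟨F, _, _, -, c, hc, rfl⟩
  refine ENNReal.div_le_of_le_mul ?_
  rw [one_mul]
  exact_mod_cast hc.length_le_key hM hG

/-- The path length depends on the graph alone, so one bound `n / (n + 1)` serves all codes and
strictness survives the supremum. -/
lemma sourceKeyCapacity_lt_one (hM : G.HasEdgeSize 1) {k : Fin K}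
    (hk : (G.core.charGraph k).HasInternalQualifiedEdge) : sourceKeyCapacity Q G < 1 := by
  obtain ⟨x, y, hq, ⟨p⟩⟩ := hk
  rw [StorageGraph.charGraph_qualifiedAdj] at hq
  refine lt_of_le_of_lt (b := (p.length : ℝ≥0∞) / ((p.length + 1 : ℕ) : ℝ≥0∞)) (sSup_le ?_) ?_
  · rintro r ⟨F, _, _, -, c, hc, rfl⟩
    have h := hc.length_le_of_walk hM (x := x) (y := y) hq.1 hq.2 p
    refine ENNReal.div_le_of_le_mul ?_
    rw [mul_comm, ← mul_div_assoc, ENNReal.le_div_iff_mul_le (Or.inl (by simp))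
      (Or.inl (ENNReal.natCast_ne_top _))]
    have h' : c.L * (p.length + 1) ≤ c.LZ * p.length := by linarith
    exact_mod_cast h'
  · refine ENNReal.div_lt_of_lt_mul ?_
    rw [one_mul]
    exact_mod_cast Nat.lt_succ_self _

lemma sourceKeyCapacity_eq_top (hM : G.HasEdgeSize 1) (hQ : Q.Nonempty)
    (hQ' : ∀ q ∈ Q, IsPrimePow q) (hG : ¬ G.coreNodes.Nonempty) : sourceKeyCapacity Q G = ⊤ := by
  obtain ⟨q, hq⟩ := hQ
  obtain ⟨p, _, F, _, _, _, rfl⟩ := exists_finite_field (hQ' q hq)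
  have hc := linearCode_isSecure (hL := Nat.one_pos) (G := G) hM
    (φ := Pi.evalAddMonoidHom (fun _ : Fin 1 => F) 0) (ψ := (0 : (Fin 0 → F) →+ F))
    (u := fun _ _ => 0)
    (fun a b hab => funext fun i => by rw [Subsingleton.elim i 0]; exact hab)
    (fun h => absurd h hG) (fun _ x => absurd ⟨x.1, x.2⟩ hG)
  refine top_le_iff.1 (le_trans (le_of_eq ?_) (le_sourceKeyCapacity hq _ hc))
  simp [StorageCode.rate, linearCode]

lemma one_le_sourceKeyCapacity [Finite V] (hM : G.HasEdgeSize 1) (hQ : Q.Nonempty)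
    (hQ' : ∀ q ∈ Q, IsPrimePow q)
    (hG : ∀ k, ¬ (G.core.charGraph k).HasInternalQualifiedEdge) :
    1 ≤ sourceKeyCapacity Q G := by
  obtain ⟨q, hq⟩ := hQ
  obtain ⟨p, _, F, _, _, _, rfl⟩ := exists_finite_field (hQ' q hq)
  -- The degree makes `q ^ n` exceed the number of nodes, hence of components. The `+ 1` keeps the
  -- block length positive even without nodes.
  let n := Nat.card V + 1
  let E := FiniteField.Extension F p n
  have hcard : Nat.card V ≤ Nat.card E := by
    rw [FiniteField.natCard_extension, Nat.card_eq_fintype_card (α := F)]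
    exact (Nat.le_succ _).trans (Nat.lt_pow_self Fintype.one_lt_card).le
  have hu : ∀ k, ∃ u : (G.core.charGraph k).unqualifiedGraph.ConnectedComponent → E,
      Function.Injective u := fun k => by
    have hsurj : Function.Surjective (G.core.charGraph k).unqualifiedGraph.connectedComponentMk :=
      Quot.mk_surjective
    have : Finite (G.core.charGraph k).unqualifiedGraph.ConnectedComponent :=
      Finite.of_surjective _ hsurj
    have h1 := Nat.card_le_card_of_surjective _ hsurj
    have h2 := Nat.card_le_card_of_injective (Subtype.val : G.coreNodes → V)
      Subtype.val_injective
    have := Fintype.ofFinite (G.core.charGraph k).unqualifiedGraph.ConnectedComponent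
    have := Fintype.ofFinite E
    rw [Nat.card_eq_fintype_card] at h1
    rw [Nat.card_eq_fintype_card (α := E)] at hcard
    obtain ⟨f⟩ := Function.Embedding.nonempty_of_card_le (h1.trans (h2.trans hcard))
    exact ⟨f, f.injective⟩
  choose u hu using hu
  -- A single isomorphism embeds both the source blocks and the key, so `L = LZ = n`.
  have φ : (Fin n → F) ≃ₗ[F] E := LinearEquiv.ofFinrankEq _ _ (by
    rw [FiniteField.finrank_extension]; simp)
  have hc := linearCode_isSecure (hL := Nat.succ_pos (Nat.card V)) (G := G) hM
    (φ := φ.toLinearMap.toAddMonoidHom) (ψ := φ.toLinearMap.toAddMonoidHom)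
    (u := fun k x => u k ((G.core.charGraph k).unqualifiedGraph.connectedComponentMk x))
    φ.injective (fun _ => φ.surjective)
    (fun k x y h => StorageGraph.mem_label_iff_coeff_ne (H := G.core) (hG k) (hu k) h)
  refine le_trans (le_of_eq ?_) (le_sourceKeyCapacity hq _ hc)
  exact (ENNReal.div_self (Nat.cast_ne_zero.2 (Nat.succ_ne_zero _))
    (ENNReal.natCast_ne_top _)).symm

lemma sourceKeyCapacity_eq_one_iff [Finite V] (hM : G.HasEdgeSize 1) (hQ : Q.Nonempty)
    (hQ' : ∀ q ∈ Q, IsPrimePow q) : sourceKeyCapacity Q G = 1 ↔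
      G.coreNodes.Nonempty ∧ ∀ k, ¬ (G.core.charGraph k).HasInternalQualifiedEdge := by
  constructor
  · intro h
    constructor
    · by_contra hG
      rw [sourceKeyCapacity_eq_top hM hQ hQ' hG] at h
      exact ENNReal.top_ne_one h
    · intro k hk
      exact (sourceKeyCapacity_lt_one hM hk).ne h
  · rintro ⟨hG, hk⟩
    exact le_antisymm (sourceKeyCapacity_le_one hM hG) (one_le_sourceKeyCapacity hM hQ hQ' hk)

/-- The key symbol occurs in each of the `K` summands, so the pad is `K * Z`. It is uniform
precisely when `K` is nonzero in `F`. -/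
lemma scalarCode_eq_linearCode {F : Type} [Field F]
    (u : (k : Fin K) → (G.core.charGraph k).unqualifiedGraph.ConnectedComponent → F) :
    scalarCode G u = linearCode G Nat.one_pos (Pi.evalAddMonoidHom (fun _ : Fin 1 => F) 0)
      ((AddMonoidHom.mulLeft (K : F)).comp (Pi.evalAddMonoidHom (fun _ : Fin 1 => F) 0))
      (fun k x => u k ((G.core.charGraph k).unqualifiedGraph.connectedComponentMk x)) := by
  refine congrArg (StorageCode.mk 1 1 Nat.one_pos fun _ => F) ?_
  funext v ω
  by_cases hv : v ∈ G.coreNodes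
  · rw [dif_pos hv, dif_pos hv]
    simp [linearHom, Finset.sum_add_distrib]
  · rw [dif_neg hv, dif_neg hv]
    rfl

lemma scalarCode_isSecure (hM : G.HasEdgeSize 1)
    (hG : ∀ k, ¬ (G.core.charGraph k).HasInternalQualifiedEdge) {F : Type} [Field F] [Fintype F]
    (hK : (K : F) ≠ 0)
    {u : (k : Fin K) → (G.core.charGraph k).unqualifiedGraph.ConnectedComponent → F}
    (hu : ∀ k, Function.Injective (u k)) : (scalarCode G u).IsSecure G := by
  rw [scalarCode_eq_linearCode]
  refine linearCode_isSecure hM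
    (fun a b hab => funext fun i => by rw [Subsingleton.elim i 0]; exact hab)
    (fun _ e => ⟨fun _ => (K : F)⁻¹ * e, ?_⟩)
    (fun k x y h => StorageGraph.mem_label_iff_coeff_ne (H := G.core) (hG k) (hu k) h)
  simp [hK]

end Capacity

end SecureStorage

theorem theorem1 {V : Type*} [Finite V] {K : ℕ} (G : SecureStorage.StorageGraph V K)
    (hM : G.HasEdgeSize 1) (Q : Set ℕ) (hQ : Q.Nonempty) (hQ' : ∀ q ∈ Q, IsPrimePow q) :
    -- every graph
    (SecureStorage.sourceKeyCapacity Q G = 1 ↔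
      G.coreNodes.Nonempty ∧ ∀ k, ¬ (G.core.charGraph k).HasInternalQualifiedEdge) ∧
    -- graphs from which the degenerate nodes have been removed
    (G.degenerateNodes = ∅ →
      (SecureStorage.sourceKeyCapacity Q G = 1 ↔
        (G.degenerateNodesᶜ).Nonempty ∧ ∀ k, ¬ (G.charGraph k).HasInternalQualifiedEdge)) ∧
    -- the rate 1 is attained by the scalar code
    ((∀ k, ¬ (G.core.charGraph k).HasInternalQualifiedEdge) →
      ∀ (F : Type) [Field F] [Fintype F], (K : F) ≠ 0 →
      ∀ u : (k : Fin K) → (G.core.charGraph k).unqualifiedGraph.ConnectedComponent → F,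
        (∀ k, Function.Injective (u k)) →
        (SecureStorage.scalarCode G u).IsSecure G ∧
          (SecureStorage.scalarCode G u).rate = 1) := by
  refine ⟨SecureStorage.sourceKeyCapacity_eq_one_iff hM hQ hQ', fun hG => ?_,
    fun hG F _ _ hK u hu => ⟨SecureStorage.scalarCode_isSecure hM hG hK hu, ?_⟩⟩
  · have hcore := SecureStorage.StorageGraph.coreNodes_eq_univ hM hG
    rw [SecureStorage.sourceKeyCapacity_eq_one_iff hM hQ hQ', hG, Set.compl_empty, ← hcore]
    exact and_congr_right fun _ => forall_congr' fun k =>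
      not_congr (SecureStorage.StorageGraph.hasInternalQualifiedEdge_induce_iff hcore k)
  · simp [SecureStorage.StorageCode.rate, SecureStorage.scalarCode]
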